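/- **Theorem (universal approximation by bin-density networks).** Let $\mathcal K=\prod_{i=1}^d[a_i,b_i]\subset\mathbb R^d$ with $a_i<b_i$ be a bounded rectangle. Let $\bar\omega:[0,\infty)\to[0,\infty)$ be a modulus of continuity, i.e. nondecreasing with $\lim_{t\downarrow0}\bar\omega(t)=\bar\omega(0)=0$, and let $\delta>0$. Let $\mathcal D_c^{\bar\omega}(\mathcal K)$ be the set of Borel probability measures $\mu$ on $\mathbb R^d$ supported in $\mathcal K$ that have a density $\mathrm p^\mu\ge 0$ with respect to Lebesgue measure $\lambda_d$ which is continuous on $\mathcal K$ and satisfies $$\omega^\mu_{\mathcal K}(t):=\sup\{|\mathrm p^\mu(x)-\mathrm p^\mu(y)|: x,y\in\mathcal K,\ |x-y|\le t\}\ \le\ \bar\omega(t)\qquad\text{for all } 0\le t<\delta .$$ Let $\mathcal P_2(\mathbb R^d)$ be the space of Borel probability measures on $\mathbb R^d$ with finite second moment, equipped with the $2$-Wasserstein distance, and let $V:\mathbb R^d\times\mathcal P_2(\mathbb R^d)\to\mathbb R^p$ be continuous. Let $\sigma:\mathbb R\to\mathbb R$ be an activation function that is continuous and not a polynomial. For $n\ge1$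 divide $\mathcal K$ into $K=n^d$ congruent rectangular bins by cutting each edge into $n$ equal parts; let $x_1,\dots,x_K$ be the centres of the bins and $h=\lambda_d(\mathcal K)/K$ their common volume, and set $$\boldsymbol p^\mu=(p^\mu_k)_{1\le k\le K},\qquad p^\mu_k=\frac{\mathrm p^\mu(x_k)}{\sum_{j=1}^K \mathrm p^\mu(x_j)\,h}.$$ Then for every $\varepsilon>0$ there exist $n\ge1$, with $K=n^d$, and a feedforward neural network $\Phi:\mathbb R^d\times\mathbb R^K\to\mathbb R^p$ with activation function $\sigma$ (finitely many hidden layers of finite widths, affine output layer) such that for every $\mu\in\mathcal D_c^{\bar\omega}(\mathcal K)$ one has $\sum_{j=1}^K\mathrm p^\mu(x_j)h>0$ (so that $\boldsymbol p^\mu$ is well defined) and $$\big|V(x,\mu)-\Phi(x,\boldsymbol p^\mu)\big|\le\varepsilon\qquad\text{for all }x\in\mathcal K .$$ -/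

import Mathlib

open MeasureTheory Filter Topology
open scoped NNReal ENNReal

namespace MeanField

/-- The Wasserstein space `P₂(ℝᵈ)` (as a type): Borel probability measures on `ℝᵈ` with finite
second moment. It is a structure, not a subtype, so that it does not inherit the topology of weak
convergence; its topology is the one of the 2-Wasserstein distance, given below. -/
structure P2 (d : ℕ) where
  toMeasure : Measure (EuclideanSpace ℝ (Fin d))
  isProbabilityMeasure : IsProbabilityMeasure toMeasure
  secondMoment_lt_top : ∫⁻ x, ‖x‖ₑ ^ 2 ∂toMeasure < ∞

/-- `π` is a coupling of `μ` and `ν`: its marginals are `μ` and `ν`. -/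
def IsCoupling {d : ℕ} (μ ν : Measure (EuclideanSpace ℝ (Fin d)))
    (π : Measure (EuclideanSpace ℝ (Fin d) × EuclideanSpace ℝ (Fin d))) : Prop :=
  π.fst = μ ∧ π.snd = ν

/-- The 2-Wasserstein distance
`W₂(μ, ν) = (inf over couplings π of ∫ |x - y|² dπ(x, y)) ^ (1/2)`. -/
noncomputable def W2 {d : ℕ} (μ ν : P2 d) : ℝ≥0∞ :=
  (⨅ (π : Measure (EuclideanSpace ℝ (Fin d) × EuclideanSpace ℝ (Fin d)))
    (_ : IsCoupling μ.toMeasure ν.toMeasure π), ∫⁻ z, edist z.1 z.2 ^ 2 ∂π) ^ (1 / 2 : ℝ)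

/-- The topology of the distance `W₂`: a set is open if it contains with each of its points
a `W₂`-ball of positive radius around it. -/
instance (d : ℕ) : TopologicalSpace (P2 d) where
  IsOpen U := ∀ μ ∈ U, ∃ r : ℝ≥0∞, 0 < r ∧ ∀ ν, W2 μ ν < r → ν ∈ U
  isOpen_univ := fun _ _ => ⟨1, one_pos, fun _ _ => Set.mem_univ _⟩
  isOpen_inter := by
    rintro U U' hU hU' μ ⟨h, h'⟩
    obtain ⟨r, hr, hr'⟩ := hU μ h
    obtain ⟨s, hs, hs'⟩ := hU' μ h'
    exact ⟨min r s, lt_min hr hs, fun ν hν =>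
      ⟨hr' ν (hν.trans_le (min_le_left _ _)), hs' ν (hν.trans_le (min_le_right _ _))⟩⟩
  isOpen_sUnion := by
    rintro S hS μ ⟨U, hU, hμ⟩
    obtain ⟨r, hr, hr'⟩ := hS U hU μ hμ
    exact ⟨r, hr, fun ν hν => ⟨U, hU, hr' ν hν⟩⟩

/-- The closed rectangle `∏ᵢ [aᵢ, bᵢ]` in `ℝᵈ`. -/
def box {d : ℕ} (a b : Fin d → ℝ) : Set (EuclideanSpace ℝ (Fin d)) :=
  {x | ∀ i, a i ≤ x i ∧ x i ≤ b i}

/-- A modulus of continuity: a nondecreasing function `ω` on `[0, ∞)` with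
`lim_{t ↓ 0} ω t = ω 0 = 0`. -/
structure IsModulus (ω : ℝ≥0 → ℝ≥0) : Prop where
  monotone : Monotone ω
  zero : ω 0 = 0
  tendsto : Tendsto ω (𝓝[>] 0) (𝓝 0)

/-- The modulus of uniform continuity of `f` on `S`,
`t ↦ sup {|f x - f y| : x, y ∈ S, |x - y| ≤ t}`, with values in `[0, ∞]`. -/
noncomputable def modulusOn {d : ℕ} (f : EuclideanSpace ℝ (Fin d) → ℝ)
    (S : Set (EuclideanSpace ℝ (Fin d))) (t : ℝ≥0) : ℝ≥0∞ :=
  ⨆ (x ∈ S) (y ∈ S) (_ : nndist x y ≤ t), edist (f x) (f y)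

/-- `μ` is supported in `S` and `f` is a density of `μ` with respect to Lebesgue measure,
continuous on `S`. -/
structure HasContinuousDensityOn {d : ℕ} (μ : P2 d) (S : Set (EuclideanSpace ℝ (Fin d)))
    (f : EuclideanSpace ℝ (Fin d) → ℝ) : Prop where
  measurable : Measurable f
  nonneg : ∀ x, 0 ≤ f x
  eq_withDensity : μ.toMeasure = volume.withDensity (fun x => ENNReal.ofReal (f x))
  measure_compl : μ.toMeasure Sᶜ = 0
  continuousOn : ContinuousOn f S

/-- The division of the rectangle `∏ᵢ [aᵢ, bᵢ]` into `n ^ d` congruent bins, each edge being cut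
into `n` equal parts: the bins are indexed by `Fin d → Fin n` (enumerated by `Fin (n ^ d)`), and the
bin with multi-index `k` is `∏ᵢ [aᵢ + kᵢ (bᵢ - aᵢ) / n, aᵢ + (kᵢ + 1) (bᵢ - aᵢ) / n]`. This is
the centre of the bin with number `k`. -/
noncomputable def binCenter {d : ℕ} (a b : Fin d → ℝ) (n : ℕ) (k : Fin (n ^ d)) :
    EuclideanSpace ℝ (Fin d) :=
  WithLp.toLp 2 fun i =>
    midpoint ℝ (a i + ((finFunctionFinEquiv.symm k i : ℕ) : ℝ) * (b i - a i) / n)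
      (a i + (((finFunctionFinEquiv.symm k i : ℕ) : ℝ) + 1) * (b i - a i) / n)

/-- The common Lebesgue measure `h = λ(∏ᵢ [aᵢ, bᵢ]) / K` of the `K = n ^ d` bins. -/
noncomputable def binVolume {d : ℕ} (a b : Fin d → ℝ) (n : ℕ) : ℝ :=
  volume.real (box a b) / ((n ^ d : ℕ) : ℝ)

/-- The normalization `∑ₖ f(xₖ) h`, where the `xₖ` are the bin centres. -/
noncomputable def binMass {d : ℕ} (a b : Fin d → ℝ) (n : ℕ)
    (f : EuclideanSpace ℝ (Fin d) → ℝ) : ℝ :=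
  ∑ k, f (binCenter a b n k) * binVolume a b n

/-- The density bins `p = (pₖ)ₖ` of a density `f`: `pₖ = f(xₖ) / ∑ⱼ f(xⱼ) h`. -/
noncomputable def binDensity {d : ℕ} (a b : Fin d → ℝ) (n : ℕ)
    (f : EuclideanSpace ℝ (Fin d) → ℝ) (k : Fin (n ^ d)) : ℝ :=
  f (binCenter a b n k) / binMass a b n f

/-- A (fully connected) feedforward neural network with `m` inputs and `q` outputs, with any number
of hidden layers of any widths, given by its weight matrices and biases; the output layer is
affine. -/
inductive FeedforwardNet : ℕ → ℕ → Type
  | output {m q : ℕ} (W : Matrix (Fin q) (Fin m) ℝ) (c : Fin q → ℝ) : FeedforwardNet m q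
  | hidden {m l q : ℕ} (W : Matrix (Fin l) (Fin m) ℝ) (c : Fin l → ℝ)
      (Φ : FeedforwardNet l q) : FeedforwardNet m q

/-- The function computed by a feedforward network with activation function `σ`, which is applied
componentwise in every hidden layer. -/
noncomputable def FeedforwardNet.eval (σ : ℝ → ℝ) :
    {m q : ℕ} → FeedforwardNet m q → (Fin m → ℝ) → (Fin q → ℝ)
  | _, _, .output W c, x => W.mulVec x + c
  | _, _, .hidden W c Φ, x => Φ.eval σ (fun i => σ ((W.mulVec x + c) i))

end MeanField

/-!
Let `D` be the set of the densities on the rectangle that have total mass one and modulus of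
continuity at most `ω` on `[0, δ)`. They are equicontinuous, and they are uniformly bounded because
a large value of one of them would force a large mass on a whole bin; so `D` is compact in the sup
norm (`isCompact_densitySet`). Two measures with densities `f` and `g` on a bounded set are coupled
by leaving the common part `min f g` in place and moving only the rest, which bounds their
Wasserstein distance by a power of `‖f - g‖` (`W2_le_of_withDensity`). Hence `(x, f) ↦ V x μ_f` is a
continuous function on the compact space `X = box × D`, and each coordinate of it is to be
approximated uniformly.

The activation `σ` enters through `mem_closed_submodule_of_separatesPoints`: if a linear space `L` of
continuous functions on a compact space separates points, then the functions `σ(ℓ + c)` with `ℓ ∈ L`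
span a dense subspace. Since `σ` is continuous and not a polynomial, for each `k` some `k`-th
difference of `σ` does not vanish (`exists_polynomial_of_fwdDiff_iter_eq_zero`). Averaging `σ` over
an interval of length `h` and differentiating in the weight `w` turns `σ(w ℓ + c)` into
`ℓ · Δ_h σ(w ℓ + c)` without leaving the closed span (`powMulComp_fwdDiff_mem`); after `k` such steps
all powers `ℓᵏ` are in the closed span, hence also `exp ℓ`. As the `exp ℓ` are closed under products,
the Stone-Weierstrass theorem concludes. Averaging makes smoothness of `σ` unnecessary.

Here `L` consists of the functions on `X` that are uniform limits, as the number of bins grows, of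
linear functions of the network inputs `(x, p)`. It contains the coordinates of `x`, and also the
evaluations `f ↦ f y`, because the midpoint sums converge to `∫ f = 1` uniformly on `D`
(`eventually_exists_abs_sub_binDensity_le`); together these separate the points of `X`. A finite
combination of functions `σ(ℓ + c)` is therefore close, for all large `n`, to a network with one
hidden layer applied to the point and the density bins (`eventually_exists_feedforwardNet`).
-/

namespace MeanField

open scoped BoundedContinuousFunction

/-! ### Continuous functions with vanishing differences -/

/-- If the `k`-th differences of step `h` vanish, then Newton's forward difference formula at `y` is a
polynomial of degree less than `k`. -/
theorem exists_polynomial_eqOn_progression {f : ℝ → ℝ} {k : ℕ} {h : ℝ} (hh : h ≠ 0)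
    (hf : ∀ c, (fwdDiff h)^[k] f c = 0) (y : ℝ) :
    ∃ P : Polynomial ℝ, ∀ n : ℕ, f (y + n * h) = P.eval (y + n * h) := by
  have hf' : ∀ j, k ≤ j → (fwdDiff h)^[j] f y = 0 := by
    intro j hj
    obtain ⟨i, rfl⟩ := Nat.exists_eq_add_of_le hj
    have h0 : (fwdDiff h)^[k] f = fun _ => 0 := funext hf
    rw [add_comm, Function.iterate_add_apply, h0]
    clear hj
    induction i with
    | zero => rfl
    | succ i ih => rwa [Function.iterate_succ_apply, fwdDiff_const]
  refine ⟨∑ j ∈ Finset.range k, Polynomial.C ((fwdDiff h)^[j] f y / j.factorial) *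
    (descPochhammer ℝ j).comp (Polynomial.C h⁻¹ * (Polynomial.X - Polynomial.C y)), fun n => ?_⟩
  have hn : ∀ j, (n.choose j : ℝ) = (descPochhammer ℝ j).eval (n : ℝ) / j.factorial := by
    intro j
    rw [descPochhammer_eval_eq_descFactorial, Nat.descFactorial_eq_factorial_mul_choose]
    push_cast
    field_simp
  have h1 : f (y + n * h) = ∑ j ∈ Finset.range k, n.choose j • (fwdDiff h)^[j] f y := by
    rw [← nsmul_eq_mul, shift_eq_sum_fwdDiff_iter h f n y]
    rcases le_total k (n + 1) with hk | hk
    · refine (Finset.sum_subset (Finset.range_mono hk) fun j _ hj => ?_).symm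
      rw [hf' j (by simpa using hj), smul_zero]
    · refine Finset.sum_subset (Finset.range_mono hk) fun j _ hj => ?_
      rw [Nat.choose_eq_zero_of_lt (by simpa using hj), zero_smul]
  rw [h1, Polynomial.eval_finsetSum]
  refine Finset.sum_congr rfl fun j _ => ?_
  have : h⁻¹ * (y + n * h - y) = n := by field_simp; ring
  simp only [Polynomial.eval_mul, Polynomial.eval_C, Polynomial.eval_comp, Polynomial.eval_sub,
    Polynomial.eval_X, this, nsmul_eq_mul, hn]
  ring

/-- A continuous function whose `k`-th differences vanish for all positive steps is a polynomial:
on each of the nested progressions `y + ℕ / N` it is one, and they all agree on `y + ℕ`. -/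
theorem exists_polynomial_of_fwdDiff_iter_eq_zero {f : ℝ → ℝ} (hc : Continuous f) {k : ℕ}
    (hf : ∀ h, 0 < h → ∀ c, (fwdDiff h)^[k] f c = 0) :
    ∃ P : Polynomial ℝ, ∀ t, f t = P.eval t := by
  -- forward differences only give the values to the right of a base point `y`
  have key : ∀ y, ∃ P : Polynomial ℝ, ∀ x, y ≤ x → f x = P.eval x := by
    intro y
    obtain ⟨P, hP⟩ := exists_polynomial_eqOn_progression one_ne_zero (hf 1 one_pos) y
    refine ⟨P, fun x hx => ?_⟩
    have hN : ∀ N n : ℕ, 0 < N → f (y + n / N) = P.eval (y + n / N) := by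
      intro N n hN
      have hN' : (0 : ℝ) < N := by exact_mod_cast hN
      obtain ⟨Q, hQ⟩ := exists_polynomial_eqOn_progression (inv_pos.2 hN').ne'
        (hf _ (inv_pos.2 hN')) y
      have hPQ : Q = P := by
        refine Polynomial.eq_of_infinite_eval_eq _ _
          ((Set.infinite_range_of_injective (f := fun n : ℕ => y + (n : ℝ))
            fun a b hab => by simpa using hab).mono ?_)
        rintro _ ⟨n, rfl⟩
        have h1 := hP n
        have h2 := hQ (n * N)
        have h3 : ((n * N : ℕ) : ℝ) * (N : ℝ)⁻¹ = n := by push_cast; field_simp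
        rw [h3] at h2
        rw [mul_one] at h1
        exact h2.symm.trans h1
      have := hQ n
      rwa [hPQ, ← div_eq_mul_inv] at this
    have hlim : Tendsto (fun N : ℕ => y + (⌊(x - y) * (N : ℝ)⌋₊ : ℝ) / (N : ℝ)) atTop (𝓝 x) := by
      have := ((tendsto_nat_floor_mul_div_atTop (sub_nonneg.2 hx)).comp
        (tendsto_natCast_atTop_atTop (R := ℝ))).const_add y
      simpa using this
    refine tendsto_nhds_unique ((hc.tendsto x).comp hlim)
      (((P.continuous.tendsto x).comp hlim).congr' ?_)
    filter_upwards [eventually_gt_atTop 0] with N hN0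
    exact (hN N _ hN0).symm
  obtain ⟨P, hP⟩ := key 0
  refine ⟨P, fun x => ?_⟩
  obtain ⟨Q, hQ⟩ := key (min x 0)
  have hPQ : Q = P := Polynomial.eq_of_infinite_eval_eq _ _
    ((Set.Ici_infinite (0 : ℝ)).mono fun t ht => by
      rw [Set.mem_ofPred_eq, ← hP t ht, ← hQ t ((min_le_right _ _).trans ht)])
  rw [hQ x (min_le_left _ _), hPQ]

/-! ### Density of ridge functions -/

section Ridge

theorem _root_.Submodule.intervalIntegral_mem {E : Type*} [NormedAddCommGroup E] [NormedSpace ℝ E]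
    [CompleteSpace E] {M : Submodule ℝ E} (hM : IsClosed (M : Set E)) {g : ℝ → E}
    (hg : Continuous g) (hgM : ∀ u, g u ∈ M) {a b : ℝ} (hab : a < b) :
    ∫ u in a..b, g u ∈ M := by
  have h := M.convex.set_average_mem hM (μ := volume) (t := Set.uIoc a b) (f := g)
    (by simp [Set.uIoc_of_le hab.le, hab]) (by simp [Set.uIoc_of_le hab.le])
    (ae_of_all _ hgM) (hg.integrableOn_uIoc)
  rw [interval_average_eq] at h
  have h2 := M.smul_mem (b - a) h
  rwa [smul_smul, mul_inv_cancel₀ (sub_pos.2 hab).ne', one_smul] at h2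

theorem _root_.Submodule.mem_of_hasDerivAt {E : Type*} [NormedAddCommGroup E] [NormedSpace ℝ E]
    {M : Submodule ℝ E} (hM : IsClosed (M : Set E)) {g : ℝ → E} {g' : E} {w : ℝ}
    (hg : HasDerivAt g g' w) (hgM : ∀ u, g u ∈ M) : g' ∈ M :=
  hM.mem_of_tendsto hg.tendsto_slope (Eventually.of_forall fun v =>
    M.smul_mem _ (M.sub_mem (hgM v) (hgM w)))

variable {X : Type*} [TopologicalSpace X]

/-- The continuous function `x ↦ ℓ(x)ʲ g(w ℓ(x) + c)`. -/
def powMulComp (ℓ : C(X, ℝ)) (j : ℕ) (g : C(ℝ, ℝ)) (w c : ℝ) : C(X, ℝ) where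
  toFun x := ℓ x ^ j * g (w * ℓ x + c)

@[simp] theorem powMulComp_apply (ℓ : C(X, ℝ)) (j : ℕ) (g : C(ℝ, ℝ)) (w c : ℝ) (x : X) :
    powMulComp ℓ j g w c x = ℓ x ^ j * g (w * ℓ x + c) := rfl

theorem continuous_powMulComp (ℓ : C(X, ℝ)) (j : ℕ) (g : C(ℝ, ℝ)) :
    Continuous fun z : ℝ × ℝ => powMulComp ℓ j g z.1 z.2 :=
  (ContinuousMap.curry
    (⟨fun y : (ℝ × ℝ) × X => ℓ y.2 ^ j * g (y.1.1 * ℓ y.2 + y.1.2), by fun_prop⟩ :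
      C((ℝ × ℝ) × X, ℝ))).continuous

/-- Differencing `g` gains a power of `ℓ`: the mean of `g(w ℓ + c + u)` over `0 ≤ u ≤ h` stays in
the closed subspace `M`, and its `w`-derivative is `ℓ (g(w ℓ + c + h) - g(w ℓ + c))`. -/
theorem powMulComp_fwdDiff_mem [CompactSpace X] {M : Submodule ℝ C(X, ℝ)}
    (hM : IsClosed (M : Set C(X, ℝ)))
    {ℓ : C(X, ℝ)} {j : ℕ} {g g' : C(ℝ, ℝ)} {h : ℝ} (hh : 0 < h) (hg' : ⇑g' = fwdDiff h g)
    (hg : ∀ w c, powMulComp ℓ j g w c ∈ M) (w c : ℝ) : powMulComp ℓ (j + 1) g' w c ∈ M := by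
  have hcw : ∀ w, Continuous fun u => powMulComp ℓ j g w (c + u) := fun w =>
    (continuous_powMulComp ℓ j g).comp (by fun_prop : Continuous fun u : ℝ => (w, c + u))
  have hce : Continuous fun v => powMulComp ℓ (j + 1) g' v c :=
    (continuous_powMulComp ℓ (j + 1) g').comp (by fun_prop : Continuous fun v : ℝ => (v, c))
  set S : ℝ → C(X, ℝ) := fun w => ∫ u in (0)..h, powMulComp ℓ j g w (c + u) with hS
  have hSM : ∀ w, S w ∈ M := fun w =>
    Submodule.intervalIntegral_mem hM (hcw w) (fun u => hg w (c + u)) hh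
  have happly : ∀ (F : ℝ → C(X, ℝ)), Continuous F → ∀ a b x,
      (∫ u in a..b, F u) x = ∫ u in a..b, F u x := fun F hF a b x =>
    (ContinuousLinearMap.intervalIntegral_comp_comm (ContinuousMap.evalCLM ℝ x)
      (hF.intervalIntegrable a b)).symm
  -- the antiderivative of `g`, whose differences are the pointwise values of `S`
  set G : ℝ → ℝ := fun s => ∫ u in (0)..s, g u with hG
  have hGd : ∀ s, HasDerivAt G (g s) s := fun s =>
    (g.continuous.integral_hasStrictDerivAt 0 s).hasDerivAt
  have hSx : ∀ w x, S w x = ℓ x ^ j * (G (w * ℓ x + c + h) - G (w * ℓ x + c)) := by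
    intro w x
    rw [hS]
    simp only [happly _ (hcw w), powMulComp_apply, intervalIntegral.integral_const_mul]
    congr 1
    have : ∀ u, w * ℓ x + (c + u) = (w * ℓ x + c) + u := fun u => by ring
    simp only [this]
    rw [intervalIntegral.integral_comp_add_left (fun u => g u), add_zero, hG,
      intervalIntegral.integral_interval_sub_left (g.continuous.intervalIntegrable _ _)
        (g.continuous.intervalIntegrable _ _)]
  -- `S` is also a primitive in `w`, so that it is differentiable in the sup norm and not only
  -- pointwise
  have hSE : S = fun w => S 0 + ∫ v in (0)..w, powMulComp ℓ (j + 1) g' v c := by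
    funext w
    ext x
    rw [ContinuousMap.add_apply, happly _ hce]
    have hSx' : (fun v => S v x) =
        fun v => ℓ x ^ j * (G (v * ℓ x + c + h) - G (v * ℓ x + c)) := funext fun v => hSx v x
    have hd : ∀ v, HasDerivAt (fun v => S v x) (powMulComp ℓ (j + 1) g' v c x) v := by
      intro v
      rw [hSx']
      have h0 : HasDerivAt (fun v => v * ℓ x + c) (ℓ x) v := by
        simpa using ((hasDerivAt_id v).mul_const (ℓ x)).add_const c
      have h1 := (hGd (v * ℓ x + c + h)).comp v (h0.add_const h)
      have h2 := (hGd (v * ℓ x + c)).comp v h0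
      refine ((h1.sub h2).const_mul (ℓ x ^ j)).congr_deriv ?_
      simp only [powMulComp_apply, hg', fwdDiff]
      ring
    rw [intervalIntegral.integral_eq_sub_of_hasDerivAt (fun v _ => hd v)
      (((ContinuousMap.evalCLM ℝ x).continuous.comp hce).intervalIntegrable _ _)]
    ring
  have hSd : HasDerivAt S (powMulComp ℓ (j + 1) g' w c) w := by
    rw [hSE]
    exact (hce.integral_hasStrictDerivAt 0 w).hasDerivAt.const_add _
  exact Submodule.mem_of_hasDerivAt hM hSd hSM

/-- A closed subspace which contains all `σ(w ℓ + c)`, for a continuous `σ` that is not a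
polynomial, contains all powers of `ℓ`. -/
theorem pow_mem_of_comp_mem [CompactSpace X] {M : Submodule ℝ C(X, ℝ)}
    (hM : IsClosed (M : Set C(X, ℝ)))
    {σ : C(ℝ, ℝ)} (hσ : ¬ ∃ P : Polynomial ℝ, ∀ t, σ t = P.eval t) {ℓ : C(X, ℝ)}
    (h : ∀ w c, powMulComp ℓ 0 σ w c ∈ M) (k : ℕ) : ℓ ^ k ∈ M := by
  obtain ⟨s, hs, c, hc⟩ : ∃ s, 0 < s ∧ ∃ c, (fwdDiff s)^[k] σ c ≠ 0 := by
    by_contra! hcon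
    exact hσ (exists_polynomial_of_fwdDiff_iter_eq_zero σ.continuous hcon)
  have key : ∀ j, ∃ g : C(ℝ, ℝ), ⇑g = (fwdDiff s)^[j] σ ∧ ∀ w c, powMulComp ℓ j g w c ∈ M := by
    intro j
    induction j with
    | zero => exact ⟨σ, rfl, h⟩
    | succ j ih =>
      obtain ⟨g, hg, hgM⟩ := ih
      refine ⟨⟨fwdDiff s g, by unfold fwdDiff; fun_prop⟩, ?_,
        powMulComp_fwdDiff_mem hM hs rfl hgM⟩
      rw [Function.iterate_succ_apply', ← hg]
      rfl
  obtain ⟨g, hg, hgM⟩ := key k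
  -- with the weight `w = 0` the function `ℓᵏ g(w ℓ + c)` is a multiple of `ℓᵏ`
  have h1 := M.smul_mem (g c)⁻¹ (hgM 0 c)
  rw [← hg] at hc
  convert h1 using 1
  ext x
  simp
  field_simp

/-- Density of ridge functions with a non-polynomial activation: the span of the `σ(ℓ + c)`, for
`ℓ` in a linear space `L` of continuous functions that separates points, is dense. All powers of
`ℓ`, hence `exp ℓ`, lie in its closure, and the exponentials `exp ℓ` span an algebra, to which the
Stone-Weierstrass theorem applies. -/
theorem mem_closed_submodule_of_separatesPoints [CompactSpace X] {M : Submodule ℝ C(X, ℝ)}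
    (hM : IsClosed (M : Set C(X, ℝ))) {σ : C(ℝ, ℝ)}
    (hσ : ¬ ∃ P : Polynomial ℝ, ∀ t, σ t = P.eval t) {L : Submodule ℝ C(X, ℝ)}
    (hL : ∀ x y, x ≠ y → ∃ ℓ ∈ L, ℓ x ≠ ℓ y)
    (h : ∀ ℓ ∈ L, ∀ c : ℝ, σ.comp (ℓ + ContinuousMap.const X c) ∈ M) (u : C(X, ℝ)) : u ∈ M := by
  have hexp : ∀ ℓ ∈ L, NormedSpace.exp ℓ ∈ M := by
    intro ℓ hℓ
    have hp := pow_mem_of_comp_mem hM hσ (ℓ := ℓ) fun w c => by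
      convert h (w • ℓ) (L.smul_mem w hℓ) c using 1
      ext x
      simp
    refine hM.mem_of_tendsto (NormedSpace.exp_series_hasSum_exp' (𝕂 := ℝ) ℓ)
      (Eventually.of_forall fun s => M.sum_mem fun n _ => M.smul_mem _ (hp n))
  let T : Submonoid C(X, ℝ) :=
    { carrier := {v | ∃ ℓ ∈ L, v = NormedSpace.exp ℓ}
      one_mem' := ⟨0, L.zero_mem, NormedSpace.exp_zero.symm⟩
      mul_mem' := by
        rintro _ _ ⟨ℓ, hℓ, rfl⟩ ⟨ℓ', hℓ', rfl⟩
        exact ⟨ℓ + ℓ', L.add_mem hℓ hℓ', NormedSpace.exp_add.symm⟩ }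
  have hTM : Subalgebra.toSubmodule (Algebra.adjoin ℝ (T : Set C(X, ℝ))) ≤ M := by
    rw [Algebra.adjoin_eq_span, Submonoid.closure_eq, Submodule.span_le]
    rintro _ ⟨ℓ, hℓ, rfl⟩
    exact hexp ℓ hℓ
  have hsep : (Algebra.adjoin ℝ (T : Set C(X, ℝ))).SeparatesPoints := by
    intro x y hxy
    obtain ⟨ℓ, hℓ, hne⟩ := hL x y hxy
    refine ⟨_, ⟨NormedSpace.exp ℓ, Algebra.subset_adjoin ⟨ℓ, hℓ, rfl⟩, rfl⟩, ?_⟩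
    have hev : ∀ z, NormedSpace.exp ℓ z = Real.exp (ℓ z) := fun z => by
      rw [Real.exp_eq_exp_ℝ]
      exact NormedSpace.map_exp (ContinuousMap.evalAlgHom ℝ ℝ z)
        (ContinuousMap.evalCLM ℝ z).continuous ℓ
    simpa [hev] using hne
  have htop := ContinuousMap.subalgebra_topologicalClosure_eq_top_of_separatesPoints _ hsep
  have hu : u ∈ (Algebra.adjoin ℝ (T : Set C(X, ℝ))).topologicalClosure := htop ▸ Algebra.mem_top
  exact closure_minimal (fun v hv => hTM hv) hM hu

end Ridge

/-! ### Networks on a sequence of feature vectors -/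

/-- The continuous functions that, for every `η > 0` and all large `n`, are uniformly within `η` of
an element of `G n`, for a sequence `G` of linear spaces of functions. -/
def asymptoticSpan {X : Type*} [TopologicalSpace X] (G : ℕ → Submodule ℝ (X → ℝ)) :
    Submodule ℝ C(X, ℝ) where
  carrier := {u | ∀ η > 0, ∀ᶠ n in atTop, ∃ g ∈ G n, ∀ x, |u x - g x| ≤ η}
  zero_mem' η hη := Eventually.of_forall fun n => ⟨0, (G n).zero_mem, fun x => by simpa using hη.le⟩
  add_mem' := by
    intro u v hu hv η hη
    filter_upwards [hu (η / 2) (half_pos hη), hv (η / 2) (half_pos hη)]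
    rintro n ⟨g, hg, hgu⟩ ⟨g', hg', hgv⟩
    refine ⟨g + g', (G n).add_mem hg hg', fun x => ?_⟩
    have h := abs_add_le (u x - g x) (v x - g' x)
    have e : (u + v) x - (g + g') x = (u x - g x) + (v x - g' x) := by
      simp only [ContinuousMap.add_apply, Pi.add_apply]; ring
    rw [e]
    linarith [hgu x, hgv x]
  smul_mem' := by
    intro r u hu η hη
    have hr : 0 < |r| + 1 := by positivity
    filter_upwards [hu (η / (|r| + 1)) (div_pos hη hr)]
    rintro n ⟨g, hg, hgu⟩
    refine ⟨r • g, (G n).smul_mem r hg, fun x => ?_⟩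
    have e : (r • u) x - (r • g) x = r * (u x - g x) := by
      simp only [ContinuousMap.smul_apply, Pi.smul_apply, smul_eq_mul]; ring
    rw [e, abs_mul]
    calc |r| * |u x - g x| ≤ (|r| + 1) * (η / (|r| + 1)) :=
          mul_le_mul (by linarith) (hgu x) (abs_nonneg _) hr.le
      _ = η := by field_simp

theorem isClosed_asymptoticSpan {X : Type*} [TopologicalSpace X] [CompactSpace X]
    (G : ℕ → Submodule ℝ (X → ℝ)) : IsClosed (asymptoticSpan G : Set C(X, ℝ)) := by
  refine isClosed_of_closure_subset fun u hu η hη => ?_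
  obtain ⟨v, hv, huv⟩ := Metric.mem_closure_iff.1 hu (η / 2) (half_pos hη)
  filter_upwards [hv (η / 2) (half_pos hη)]
  rintro n ⟨g, hg, hgv⟩
  refine ⟨g, hg, fun x => ?_⟩
  have h1 : |u x - v x| ≤ η / 2 := by
    rw [← Real.dist_eq]
    exact (ContinuousMap.dist_apply_le_dist x).trans huv.le
  linarith [abs_sub_le (u x) (v x) (g x), hgv x]

/-- The functions `x ↦ ⟪w, z(x)⟫` of a feature vector `z`. -/
def linearSpan {X : Type*} {m : ℕ} (z : X → Fin m → ℝ) : Submodule ℝ (X → ℝ) :=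
  Submodule.span ℝ (Set.range fun i x => z x i)

/-- The linear combinations of `x ↦ σ(⟪w, z(x)⟫ + c)`: the one-hidden-layer networks applied to a
feature vector `z`. -/
def shallowSpan {X : Type*} {m : ℕ} (σ : ℝ → ℝ) (z : X → Fin m → ℝ) : Submodule ℝ (X → ℝ) :=
  Submodule.span ℝ (Set.range fun (q : (Fin m → ℝ) × ℝ) x => σ (q.1 ⬝ᵥ z x + q.2))

/-- `p` functions in the shallow span are the outputs of a single network: its hidden layer has one
neuron for every ridge function that occurs in one of them. -/
theorem exists_feedforwardNet {X : Type*} {m p : ℕ} (σ : ℝ → ℝ) (z : X → Fin m → ℝ)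
    (g : Fin p → X → ℝ) (hg : ∀ i, g i ∈ shallowSpan σ z) :
    ∃ Φ : FeedforwardNet m p, ∀ x i, Φ.eval σ (z x) i = g i x := by
  classical
  choose α hα using fun i => Finsupp.mem_span_range_iff_exists_finsupp.1 (hg i)
  let T : Finset ((Fin m → ℝ) × ℝ) := Finset.univ.biUnion fun i => (α i).support
  let e := T.equivFin.symm
  refine ⟨.hidden (Matrix.of fun j => (e j).1.1) (fun j => (e j).1.2)
    (.output (Matrix.of fun i j => α i (e j).1) 0), fun x i => ?_⟩
  have h1 : g i x = ∑ q ∈ T, α i q * σ (q.1 ⬝ᵥ z x + q.2) := by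
    rw [← hα i, Finsupp.sum, Finset.sum_apply]
    refine Finset.sum_subset (Finset.subset_biUnion_of_mem (fun i => (α i).support)
      (Finset.mem_univ i)) fun q _ hq => ?_
    rw [Finsupp.notMem_support_iff.1 hq]
    simp
  rw [h1, ← Finset.sum_coe_sort T, ← e.sum_comp]
  simp [FeedforwardNet.eval, Matrix.mulVec, dotProduct]

/-- Applying a continuous `σ` turns asymptotically linear functions of the features into
asymptotic one-hidden-layer networks, as `σ` is uniformly continuous on bounded sets. -/
theorem comp_mem_asymptoticSpan {X : Type*} [TopologicalSpace X] [CompactSpace X] {m : ℕ → ℕ}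
    (z : ∀ n, X → Fin (m n) → ℝ) (σ : C(ℝ, ℝ)) {ℓ : C(X, ℝ)}
    (hℓ : ℓ ∈ asymptoticSpan fun n => linearSpan (z n)) (c : ℝ) :
    σ.comp (ℓ + ContinuousMap.const X c) ∈ asymptoticSpan fun n => shallowSpan σ (z n) := by
  intro η hη
  obtain ⟨R, hR⟩ : ∃ R, ∀ x, |ℓ x + c| ≤ R :=
    ⟨‖ℓ + ContinuousMap.const X c‖, fun x => (ℓ + ContinuousMap.const X c).norm_coe_le_norm x⟩
  have hu : UniformContinuousOn σ (Metric.closedBall 0 (R + 1)) :=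
    (isCompact_closedBall _ _).uniformContinuousOn_of_continuous σ.continuous.continuousOn
  obtain ⟨τ, hτ, hστ⟩ := Metric.uniformContinuousOn_iff_le.1 hu η hη
  filter_upwards [hℓ (min τ 1) (lt_min hτ one_pos)]
  rintro n ⟨g, hg, hgℓ⟩
  obtain ⟨w, hw⟩ := (Submodule.mem_span_range_iff_exists_fun ℝ).1 hg
  refine ⟨fun x => σ (w ⬝ᵥ z n x + c), Submodule.subset_span ⟨(w, c), rfl⟩, fun x => ?_⟩
  have hgx : g x = w ⬝ᵥ z n x := by
    rw [← hw]
    simp [dotProduct]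
  have h1 := hgℓ x
  rw [hgx] at h1
  have h2 := abs_le.1 (h1.trans (min_le_right _ _))
  have h3 := abs_le.1 (hR x)
  have h4 := hστ (ℓ x + c) (by
      rw [mem_closedBall_zero_iff, Real.norm_eq_abs]; linarith [hR x]) (w ⬝ᵥ z n x + c) (by
      rw [mem_closedBall_zero_iff, Real.norm_eq_abs, abs_le]; constructor <;> linarith) (by
      rw [Real.dist_eq, add_sub_add_right_eq_sub]; exact h1.trans (min_le_left _ _))
  rwa [Real.dist_eq] at h4

theorem _root_.EuclideanSpace.norm_le_sum_abs {ι : Type*} [Fintype ι] (x : EuclideanSpace ℝ ι) :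
    ‖x‖ ≤ ∑ i, |x i| := by
  rw [EuclideanSpace.norm_eq]
  refine Real.sqrt_le_iff.2 ⟨Finset.sum_nonneg fun _ _ => abs_nonneg _, ?_⟩
  simp only [Real.norm_eq_abs]
  exact Finset.sum_sq_le_sq_sum_of_nonneg fun _ _ => abs_nonneg _

/-- Universal approximation through a sequence of feature maps `z n`: it is enough that the
functions which are asymptotically linear in the features separate the points of `X`. -/
theorem eventually_exists_feedforwardNet {X : Type*} [TopologicalSpace X] [CompactSpace X]
    {m : ℕ → ℕ} (z : ∀ n, X → Fin (m n) → ℝ) {σ : ℝ → ℝ} (hσ : Continuous σ)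
    (hσ' : ¬ ∃ P : Polynomial ℝ, ∀ t, σ t = P.eval t)
    (hz : ∀ x y, x ≠ y → ∃ ℓ ∈ asymptoticSpan fun n => linearSpan (z n), ℓ x ≠ ℓ y)
    {p : ℕ} {v : X → EuclideanSpace ℝ (Fin p)} (hv : Continuous v) {ε : ℝ} (hε : 0 < ε) :
    ∀ᶠ n in atTop, ∃ Φ : FeedforwardNet (m n) p, ∀ x,
      ‖v x - WithLp.toLp 2 (Φ.eval σ (z n x))‖ ≤ ε := by
  have hp : (0 : ℝ) < p + 1 := by positivity
  have hmem : ∀ i, (⟨fun x => v x i, by fun_prop⟩ : C(X, ℝ)) ∈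
      asymptoticSpan fun n => shallowSpan σ (z n) := fun i =>
    mem_closed_submodule_of_separatesPoints (isClosed_asymptoticSpan _) (σ := ⟨σ, hσ⟩) hσ' hz
      (fun ℓ hℓ c => comp_mem_asymptoticSpan z ⟨σ, hσ⟩ hℓ c) _
  filter_upwards [eventually_all.2 fun i => hmem i (ε / (p + 1)) (div_pos hε hp)] with n hn
  choose g hg hgv using hn
  obtain ⟨Φ, hΦ⟩ := exists_feedforwardNet σ (z n) g hg
  refine ⟨Φ, fun x => ?_⟩
  calc ‖v x - WithLp.toLp 2 (Φ.eval σ (z n x))‖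
      ≤ ∑ i, |(v x - WithLp.toLp 2 (Φ.eval σ (z n x))) i| := EuclideanSpace.norm_le_sum_abs _
    _ ≤ ∑ _i : Fin p, ε / (p + 1) := Finset.sum_le_sum fun i _ => by
        have h := hgv i x
        rw [← hΦ x i] at h
        exact h
    _ = p / (p + 1) * ε := by simp; ring
    _ ≤ ε := mul_le_of_le_one_left hε.le ((div_le_one hp).2 (by linarith))

variable {d : ℕ} {a b : Fin d → ℝ}

/-! ### The division of the rectangle into bins -/

theorem box_eq_preimage (a b : Fin d → ℝ) :
    box a b = (WithLp.ofLp : EuclideanSpace ℝ (Fin d) → Fin d → ℝ) ⁻¹' Set.Icc a b := by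
  ext x
  simp [box, Pi.le_def, forall_and]

theorem isClosed_box (a b : Fin d → ℝ) : IsClosed (box a b) := by
  rw [box_eq_preimage]
  exact isClosed_Icc.preimage (PiLp.continuous_ofLp 2 _)

theorem measurableSet_box (a b : Fin d → ℝ) : MeasurableSet (box a b) :=
  (isClosed_box a b).measurableSet

theorem isCompact_box (a b : Fin d → ℝ) : IsCompact (box a b) := by
  rw [box_eq_preimage]
  exact (PiLp.homeomorph 2 (fun _ : Fin d => ℝ)).isCompact_preimage.2 isCompact_Icc

theorem volume_box_lt_top (a b : Fin d → ℝ) : volume (box a b) < ∞ :=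
  (isCompact_box a b).measure_lt_top

theorem volume_real_box (hab : ∀ i, a i ≤ b i) : volume.real (box a b) = ∏ i, (b i - a i) := by
  rw [box_eq_preimage, measureReal_def, (PiLp.volume_preserving_ofLp (Fin d)).measure_preimage
    measurableSet_Icc.nullMeasurableSet, ← Set.pi_univ_Icc, volume_pi_pi]
  simp only [Real.volume_Icc, ENNReal.toReal_prod]
  exact Finset.prod_congr rfl fun i _ => ENNReal.toReal_ofReal (sub_nonneg.2 (hab i))

theorem volume_real_box_pos (hab : ∀ i, a i < b i) : 0 < volume.real (box a b) := by
  rw [volume_real_box fun i => (hab i).le]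
  exact Finset.prod_pos fun i _ => sub_pos.2 (hab i)

/-- The half-open rectangle `∏ᵢ [aᵢ, bᵢ)`. -/
def halfOpenBox (a b : Fin d → ℝ) : Set (EuclideanSpace ℝ (Fin d)) :=
  {x | ∀ i, a i ≤ x i ∧ x i < b i}

theorem halfOpenBox_eq_preimage (a b : Fin d → ℝ) :
    halfOpenBox a b = (WithLp.ofLp : EuclideanSpace ℝ (Fin d) → Fin d → ℝ) ⁻¹'
      Set.univ.pi fun i => Set.Ico (a i) (b i) := by
  ext x
  simp [halfOpenBox]

theorem measurableSet_halfOpenBox (a b : Fin d → ℝ) : MeasurableSet (halfOpenBox a b) := by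
  rw [halfOpenBox_eq_preimage]
  exact (PiLp.volume_preserving_ofLp (Fin d)).measurable
    (MeasurableSet.univ_pi fun i => measurableSet_Ico)

theorem volume_halfOpenBox (a b : Fin d → ℝ) :
    volume (halfOpenBox a b) = ∏ i, ENNReal.ofReal (b i - a i) := by
  rw [halfOpenBox_eq_preimage, (PiLp.volume_preserving_ofLp (Fin d)).measure_preimage
    (MeasurableSet.univ_pi fun i => measurableSet_Ico).nullMeasurableSet, Real.volume_pi_Ico]

theorem halfOpenBox_subset_box (a b : Fin d → ℝ) : halfOpenBox a b ⊆ box a b :=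
  fun _ hx i => ⟨(hx i).1, (hx i).2.le⟩

theorem halfOpenBox_ae_eq_box (a b : Fin d → ℝ) : halfOpenBox a b =ᵐ[volume] box a b := by
  refine ae_eq_of_subset_of_measure_ge (halfOpenBox_subset_box a b) ?_
    (measurableSet_halfOpenBox a b).nullMeasurableSet (volume_box_lt_top a b).ne
  rw [volume_halfOpenBox, box_eq_preimage, (PiLp.volume_preserving_ofLp (Fin d)).measure_preimage
    measurableSet_Icc.nullMeasurableSet, Real.volume_Icc_pi]

/-- The lower end of the `i`-th edge of the bin with number `k`. -/
noncomputable def binLower (a b : Fin d → ℝ) (n : ℕ) (k : Fin (n ^ d)) (i : Fin d) : ℝ :=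
  a i + ((finFunctionFinEquiv.symm k i : ℕ) : ℝ) * (b i - a i) / n

/-- The upper end of the `i`-th edge of the bin with number `k`. -/
noncomputable def binUpper (a b : Fin d → ℝ) (n : ℕ) (k : Fin (n ^ d)) (i : Fin d) : ℝ :=
  a i + (((finFunctionFinEquiv.symm k i : ℕ) : ℝ) + 1) * (b i - a i) / n

theorem binUpper_sub_binLower (a b : Fin d → ℝ) (n : ℕ) (k : Fin (n ^ d)) (i : Fin d) :
    binUpper a b n k i - binLower a b n k i = (b i - a i) / n := by
  unfold binUpper binLower
  ring

theorem box_bin_subset_box (hab : ∀ i, a i < b i) {n : ℕ} (hn : 0 < n) (k : Fin (n ^ d)) :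
    box (binLower a b n k) (binUpper a b n k) ⊆ box a b := by
  intro x hx i
  have hn' : (0 : ℝ) < n := by exact_mod_cast hn
  have h := sub_pos.2 (hab i)
  have hk : ((finFunctionFinEquiv.symm k i : ℕ) : ℝ) + 1 ≤ n := by
    exact_mod_cast (finFunctionFinEquiv.symm k i).isLt
  constructor
  · refine le_trans ?_ (hx i).1
    unfold binLower
    have : 0 ≤ ((finFunctionFinEquiv.symm k i : ℕ) : ℝ) * (b i - a i) / n := by positivity
    linarith
  · refine (hx i).2.trans ?_
    unfold binUpper
    have : (((finFunctionFinEquiv.symm k i : ℕ) : ℝ) + 1) * (b i - a i) / n ≤ b i - a i := by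
      rw [div_le_iff₀ hn', mul_comm]
      exact mul_le_mul_of_nonneg_left hk h.le
    linarith

theorem binCenter_mem_box_bin (hab : ∀ i, a i < b i) {n : ℕ} (hn : 0 < n) (k : Fin (n ^ d)) :
    binCenter a b n k ∈ box (binLower a b n k) (binUpper a b n k) := by
  intro i
  have hn' : (0 : ℝ) < n := by exact_mod_cast hn
  have h : 0 < (b i - a i) / n := div_pos (sub_pos.2 (hab i)) hn'
  have e : binCenter a b n k i = midpoint ℝ (binLower a b n k i) (binUpper a b n k i) := rfl
  rw [← binUpper_sub_binLower a b n k i, sub_pos] at h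
  rw [e]
  exact ⟨left_le_midpoint.2 h.le, midpoint_le_right.2 h.le⟩

theorem binCenter_mem_box (hab : ∀ i, a i < b i) {n : ℕ} (hn : 0 < n) (k : Fin (n ^ d)) :
    binCenter a b n k ∈ box a b :=
  box_bin_subset_box hab hn k (binCenter_mem_box_bin hab hn k)

theorem dist_le_of_mem_box_bin {n : ℕ} {k : Fin (n ^ d)} {x y : EuclideanSpace ℝ (Fin d)}
    (hx : x ∈ box (binLower a b n k) (binUpper a b n k))
    (hy : y ∈ box (binLower a b n k) (binUpper a b n k)) :
    dist x y ≤ (∑ i, (b i - a i)) / n := by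
  rw [dist_eq_norm, Finset.sum_div]
  refine (EuclideanSpace.norm_le_sum_abs _).trans (Finset.sum_le_sum fun i _ => ?_)
  rw [← binUpper_sub_binLower a b n k i, PiLp.sub_apply, abs_le]
  constructor <;> linarith [hx i, hy i]

theorem volume_real_halfOpenBox_bin (hab : ∀ i, a i < b i) {n : ℕ} (k : Fin (n ^ d)) :
    volume.real (halfOpenBox (binLower a b n k) (binUpper a b n k)) = binVolume a b n := by
  rw [measureReal_def, volume_halfOpenBox, ENNReal.toReal_prod, binVolume,
    volume_real_box fun i => (hab i).le]
  simp only [binUpper_sub_binLower]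
  rw [Finset.prod_congr rfl fun i _ => ENNReal.toReal_ofReal
    (div_nonneg (sub_pos.2 (hab i)).le n.cast_nonneg), Finset.prod_div_distrib]
  simp

theorem binVolume_pos (hab : ∀ i, a i < b i) {n : ℕ} (hn : 0 < n) : 0 < binVolume a b n :=
  div_pos (volume_real_box_pos hab) (by positivity)

/-- Cutting an edge into `n` equal parts: the parts, as half-open intervals, cover it except for its
right end. -/
theorem exists_mem_part {s t x : ℝ} {n : ℕ} (hn : 0 < n) (hx : s ≤ x) (hx' : x < t) :
    ∃ j : Fin n, s + (j : ℕ) * (t - s) / n ≤ x ∧ x < s + ((j : ℕ) + 1) * (t - s) / n := by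
  have hn' : (0 : ℝ) < n := by exact_mod_cast hn
  have hst : 0 < t - s := by linarith
  have h0 : 0 ≤ (x - s) * n / (t - s) :=
    div_nonneg (mul_nonneg (by linarith) hn'.le) hst.le
  have h1 := Nat.floor_le h0
  have h2 := Nat.lt_floor_add_one ((x - s) * n / (t - s))
  have hlt : ⌊(x - s) * n / (t - s)⌋₊ < n := by
    rw [Nat.floor_lt h0, div_lt_iff₀ hst, mul_comm]
    exact mul_lt_mul_of_pos_left (by linarith) hn'
  refine ⟨⟨_, hlt⟩, ?_, ?_⟩
  · rw [le_div_iff₀ hst] at h1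
    rw [← le_sub_iff_add_le', div_le_iff₀ hn']
    exact h1
  · rw [div_lt_iff₀ hst] at h2
    rw [← sub_lt_iff_lt_add', lt_div_iff₀ hn']
    exact h2

theorem iUnion_halfOpenBox_bin (hab : ∀ i, a i < b i) {n : ℕ} (hn : 0 < n) :
    ⋃ k, halfOpenBox (binLower a b n k) (binUpper a b n k) = halfOpenBox a b := by
  ext x
  rw [Set.mem_iUnion]
  constructor
  · rintro ⟨k, hx⟩ i
    refine ⟨(box_bin_subset_box hab hn k (halfOpenBox_subset_box _ _ hx) i).1,
      (hx i).2.trans_le ?_⟩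
    have h : binUpper a b n k ∈ (WithLp.toLp 2 ⁻¹' box a b : Set (Fin d → ℝ)) :=
      box_bin_subset_box hab hn k fun i => ⟨((hx i).1.trans (hx i).2.le), le_rfl⟩
    exact (h i).2
  · intro hx
    choose j hj using fun i => exists_mem_part hn (hx i).1 (hx i).2
    refine ⟨finFunctionFinEquiv j, fun i => ?_⟩
    simpa [binLower, binUpper] using hj i

theorem disjoint_halfOpenBox_bin (hab : ∀ i, a i < b i) {n : ℕ} {k l : Fin (n ^ d)} (hkl : k ≠ l) :
    Disjoint (halfOpenBox (binLower a b n k) (binUpper a b n k))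
      (halfOpenBox (binLower a b n l) (binUpper a b n l)) := by
  rw [Set.disjoint_left]
  intro x hx hx'
  refine hkl (finFunctionFinEquiv.symm.injective (funext fun i => Fin.ext ?_))
  have hn' : (0 : ℝ) < n := by exact_mod_cast (finFunctionFinEquiv.symm k i).pos
  have h : 0 < (b i - a i) / n := div_pos (sub_pos.2 (hab i)) hn'
  have h1 := (hx i).1.trans_lt (hx' i).2
  have h2 := (hx' i).1.trans_lt (hx i).2
  simp only [binLower, binUpper, add_lt_add_iff_left, mul_div_assoc, mul_lt_mul_iff_left₀ h]
    at h1 h2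
  have h3 : (finFunctionFinEquiv.symm k i : ℕ) < (finFunctionFinEquiv.symm l i : ℕ) + 1 := by
    exact_mod_cast h1
  have h4 : (finFunctionFinEquiv.symm l i : ℕ) < (finFunctionFinEquiv.symm k i : ℕ) + 1 := by
    exact_mod_cast h2
  omega

theorem exists_mem_box_bin (hab : ∀ i, a i < b i) {n : ℕ} (hn : 0 < n)
    {x : EuclideanSpace ℝ (Fin d)} (hx : x ∈ box a b) :
    ∃ k, x ∈ box (binLower a b n k) (binUpper a b n k) := by
  have hn' : (0 : ℝ) < n := by exact_mod_cast hn
  have hj : ∀ i, ∃ j : Fin n, a i + (j : ℕ) * (b i - a i) / n ≤ x i ∧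
      x i ≤ a i + ((j : ℕ) + 1) * (b i - a i) / n := by
    intro i
    rcases (hx i).2.lt_or_eq with h | h
    · obtain ⟨j, h1, h2⟩ := exists_mem_part hn (hx i).1 h
      exact ⟨j, h1, h2.le⟩
    · refine ⟨⟨n - 1, by omega⟩, ?_⟩
      have hc : ((n - 1 : ℕ) : ℝ) = n - 1 := by push_cast [Nat.cast_sub hn]; ring
      have h2 : a i + (n - 1 + 1) * (b i - a i) / n = b i := by field_simp; ring
      have h3 : 0 ≤ (b i - a i) / n := div_nonneg (sub_pos.2 (hab i)).le hn'.le
      have h4 : (n - 1 + 1) * (b i - a i) / n = (n - 1) * (b i - a i) / n + (b i - a i) / n := by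
        ring
      simp only [hc, h]
      constructor <;> linarith
  choose j hj using hj
  refine ⟨finFunctionFinEquiv j, fun i => ?_⟩
  simpa [binLower, binUpper] using hj i

/-- The error of the midpoint sum is at most the oscillation of `f` on the bins times the volume. -/
theorem abs_integral_sub_binMass_le (hab : ∀ i, a i < b i) {n : ℕ} (hn : 0 < n)
    {f : EuclideanSpace ℝ (Fin d) → ℝ} (hf : IntegrableOn f (box a b)) {η : ℝ}
    (hη : ∀ x ∈ box a b, ∀ y ∈ box a b, dist x y ≤ (∑ i, (b i - a i)) / n → |f x - f y| ≤ η) :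
    |(∫ x in box a b, f x) - binMass a b n f| ≤ η * volume.real (box a b) := by
  set B : Fin (n ^ d) → Set (EuclideanSpace ℝ (Fin d)) :=
    fun k => halfOpenBox (binLower a b n k) (binUpper a b n k)
  have hBv : ∀ k, volume.real (B k) = binVolume a b n := fun k => volume_real_halfOpenBox_bin hab k
  have hBsub : ∀ k, B k ⊆ box a b := fun k =>
    (halfOpenBox_subset_box _ _).trans (box_bin_subset_box hab hn k)
  have hBfin : ∀ k, volume (B k) < ∞ := fun k =>
    (measure_mono (hBsub k)).trans_lt (volume_box_lt_top a b)
  have hBf : ∀ k, IntegrableOn f (B k) := fun k => hf.mono_set (hBsub k)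
  have h1 : ∫ x in box a b, f x = ∑ k, ∫ x in B k, f x := by
    rw [← setIntegral_congr_set (halfOpenBox_ae_eq_box a b), ← iUnion_halfOpenBox_bin hab hn]
    exact integral_iUnion_fintype (fun k => measurableSet_halfOpenBox _ _)
      (fun k l hkl => disjoint_halfOpenBox_bin hab hkl) hBf
  have h2 : ∀ k, |(∫ x in B k, f x) - f (binCenter a b n k) * binVolume a b n| ≤
      η * binVolume a b n := by
    intro k
    have e : f (binCenter a b n k) * binVolume a b n = ∫ _ in B k, f (binCenter a b n k) := by
      rw [setIntegral_const, hBv, smul_eq_mul, mul_comm]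
    rw [e, ← integral_sub (hBf k) (integrableOn_const (hBfin k).ne), ← hBv k]
    rw [← Real.norm_eq_abs]
    refine norm_setIntegral_le_of_norm_le_const (hBfin k) fun x hx => ?_
    exact hη x (hBsub k hx) _ (binCenter_mem_box hab hn k)
      (dist_le_of_mem_box_bin (halfOpenBox_subset_box _ _ hx) (binCenter_mem_box_bin hab hn k))
  rw [h1, binMass, ← Finset.sum_sub_distrib]
  refine (Finset.abs_sum_le_sum_abs _ _).trans ((Finset.sum_le_sum fun k _ => h2 k).trans ?_)
  have hn' : ((n ^ d : ℕ) : ℝ) ≠ 0 := by positivity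
  rw [Finset.sum_const, Finset.card_fin, nsmul_eq_mul, binVolume]
  field_simp
  exact le_rfl

/-! ### Wasserstein distance of measures with densities -/

/-- Two measures with densities `F` and `G`, living on a set of diameter at most `R`, are coupled by
leaving the common part `min F G` in place and transporting the remaining parts `F - G` and `G - F`
into each other by their normalized product. -/
theorem W2_le_of_withDensity {μ ν : P2 d} {ρ : Measure (EuclideanSpace ℝ (Fin d))} [SFinite ρ]
    {F G : EuclideanSpace ℝ (Fin d) → ℝ≥0∞} (hF : Measurable F) (hG : Measurable G)
    (hμ : μ.toMeasure = ρ.withDensity F) (hν : ν.toMeasure = ρ.withDensity G)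
    {S : Set (EuclideanSpace ℝ (Fin d))} (hS : ∀ᵐ x ∂ρ, x ∈ S) {R : ℝ≥0∞}
    (hR : ∀ x ∈ S, ∀ y ∈ S, edist x y ≤ R) :
    W2 μ ν ≤ (R ^ 2 * ∫⁻ x, (F x - G x) ∂ρ) ^ (1 / 2 : ℝ) := by
  have hμ1 := μ.isProbabilityMeasure
  have hν1 := ν.isProbabilityMeasure
  have hFG : Measurable (F - G) := hF.sub hG
  have hGF : Measurable (G - F) := hG.sub hF
  have hmin : Measurable (F ⊓ G) := hF.min hG
  set γ := ρ.withDensity (F ⊓ G) with hγ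
  set α := ρ.withDensity (F - G) with hα
  set β := ρ.withDensity (G - F) with hβ
  have e1 : α + γ = μ.toMeasure := by
    rw [hμ, hα, hγ, ← withDensity_add_left hFG]
    congr 1
    funext x
    exact tsub_add_min
  have e2 : β + γ = ν.toMeasure := by
    rw [hν, hβ, hγ, ← withDensity_add_left hGF]
    congr 1
    funext x
    simp only [Pi.add_apply, Pi.sub_apply, Pi.inf_apply]
    rw [inf_comm]
    exact tsub_add_min
  have hαle : α Set.univ ≤ 1 := by
    rw [← measure_univ (μ := μ.toMeasure), ← e1]
    exact le_self_add
  have hγle : γ Set.univ ≤ 1 := by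
    rw [← measure_univ (μ := μ.toMeasure), ← e1]
    exact le_add_self
  set m := α Set.univ with hm
  have hβm : β Set.univ = m := by
    have h1 : α Set.univ + γ Set.univ = 1 := by
      rw [← Measure.add_apply, e1, measure_univ]
    have h2 : β Set.univ + γ Set.univ = 1 := by
      rw [← Measure.add_apply, e2, measure_univ]
    exact (ENNReal.add_left_inj (hγle.trans_lt ENNReal.one_lt_top).ne).1 (h2.trans h1.symm)
  have hmtop : m ≠ ∞ := (hαle.trans_lt ENNReal.one_lt_top).ne
  have hmF : m = ∫⁻ x, (F x - G x) ∂ρ := by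
    rw [hm, hα, withDensity_apply _ MeasurableSet.univ, Measure.restrict_univ]
    rfl
  have hdiag : Measurable fun x : EuclideanSpace ℝ (Fin d) => (x, x) := by fun_prop
  -- if `m = 0`, then the transported part vanishes, so that `m⁻¹ = ∞` does no harm
  set π := γ.map (fun x => (x, x)) + m⁻¹ • α.prod β with hπ
  have hsm : ∀ κ : Measure (EuclideanSpace ℝ (Fin d)), κ Set.univ = m → m⁻¹ • m • κ = κ := by
    intro κ hκ
    rcases eq_or_ne m 0 with h0 | h0
    · rw [h0, Measure.measure_univ_eq_zero] at hκ
      simp [hκ]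
    · rw [smul_smul, ENNReal.inv_mul_cancel h0 hmtop, one_smul]
  have hc : IsCoupling μ.toMeasure ν.toMeasure π := by
    constructor
    · rw [hπ, Measure.fst_add, Measure.fst, Measure.fst, Measure.map_smul,
        Measure.map_map measurable_fst hdiag, Measure.map_fst_prod, hβm, hsm _ rfl, ← e1, add_comm]
      congr 1
      exact Measure.map_id
    · rw [hπ, Measure.snd_add, Measure.snd, Measure.snd, Measure.map_smul,
        Measure.map_map measurable_snd hdiag, Measure.map_snd_prod, ← hm, hsm _ hβm, ← e2, add_comm]
      congr 1
      exact Measure.map_id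
  have hRae : ∀ᵐ z ∂α.prod β, edist z.1 z.2 ^ 2 ≤ R ^ 2 := by
    have h1 : ∀ᵐ z ∂α.prod β, z.1 ∈ S := Measure.quasiMeasurePreserving_fst.ae
      ((withDensity_absolutelyContinuous ρ _).ae_le hS)
    have h2 : ∀ᵐ z ∂α.prod β, z.2 ∈ S := Measure.quasiMeasurePreserving_snd.ae
      ((withDensity_absolutelyContinuous ρ _).ae_le hS)
    filter_upwards [h1, h2] with z hz1 hz2
    exact pow_le_pow_left' (hR _ hz1 _ hz2) 2
  refine ENNReal.rpow_le_rpow ((iInf₂_le π hc).trans ?_) (by norm_num)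
  rw [hπ, lintegral_add_measure, lintegral_map (by fun_prop) hdiag, lintegral_smul_measure]
  simp only [edist_self, ne_eq, OfNat.ofNat_ne_zero, not_false_eq_true, zero_pow, lintegral_zero,
    zero_add]
  calc m⁻¹ • ∫⁻ z, edist z.1 z.2 ^ 2 ∂α.prod β ≤ m⁻¹ • ∫⁻ _, R ^ 2 ∂α.prod β := by
        gcongr 1
        exact lintegral_mono_ae hRae
    _ = R ^ 2 * (m⁻¹ * m * m) := by
        rw [lintegral_const, ← Set.univ_prod_univ, Measure.prod_prod, hβm, ← hm, smul_eq_mul]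
        ring
    _ ≤ R ^ 2 * (1 * m) := by
        gcongr
        exact ENNReal.inv_mul_le_one _
    _ = R ^ 2 * ∫⁻ x, (F x - G x) ∂ρ := by rw [one_mul, hmF]

/-! ### Compactness of the class of densities -/

instance compactSpace_box (a b : Fin d → ℝ) : CompactSpace (box a b) :=
  isCompact_iff_compactSpace.1 (isCompact_box a b)

/-- The extension by zero to `ℝᵈ` of a function on the rectangle. -/
noncomputable def extendZero (f : box a b →ᵇ ℝ) : EuclideanSpace ℝ (Fin d) → ℝ :=
  Function.extend Subtype.val f 0

theorem extendZero_apply (f : box a b →ᵇ ℝ) (x : box a b) : extendZero f x = f x :=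
  Subtype.val_injective.extend_apply _ _ _

theorem extendZero_of_mem (f : box a b →ᵇ ℝ) {x : EuclideanSpace ℝ (Fin d)} (hx : x ∈ box a b) :
    extendZero f x = f ⟨x, hx⟩ :=
  extendZero_apply f ⟨x, hx⟩

theorem measurable_extendZero (f : box a b →ᵇ ℝ) : Measurable (extendZero f) :=
  (MeasurableEmbedding.subtype_coe (measurableSet_box a b)).measurable_extend
    f.continuous.measurable measurable_zero

theorem integrableOn_extendZero (f : box a b →ᵇ ℝ) : IntegrableOn (extendZero f) (box a b) := by
  refine Measure.integrableOn_of_bounded (volume_box_lt_top a b).ne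
    (measurable_extendZero f).aestronglyMeasurable (M := ‖f‖)
    ((ae_restrict_iff' (measurableSet_box a b)).2 (ae_of_all _ fun x hx => ?_))
  rw [extendZero_of_mem f hx]
  exact f.norm_coe_le_norm _

/-- The continuous probability densities on the rectangle whose modulus of continuity is at most `ω`
on `[0, δ)`, as a subset of the Banach space of continuous functions. -/
def densitySet (a b : Fin d → ℝ) (ω : ℝ≥0 → ℝ≥0) (δ : ℝ≥0) : Set (box a b →ᵇ ℝ) :=
  {f | (∀ x, 0 ≤ f x) ∧ ∫ x in box a b, extendZero f x = 1 ∧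
    ∀ x y, nndist x y < δ → nndist (f x) (f y) ≤ ω (nndist x y)}

theorem continuous_integral_extendZero :
    Continuous fun f : box a b →ᵇ ℝ => ∫ x in box a b, extendZero f x := by
  refine (LipschitzWith.of_dist_le_mul (K := (volume (box a b)).toNNReal) fun f g => ?_).continuous
  rw [Real.dist_eq, ← integral_sub (integrableOn_extendZero f) (integrableOn_extendZero g),
    ← Real.norm_eq_abs, mul_comm]
  refine norm_setIntegral_le_of_norm_le_const (volume_box_lt_top a b) fun x hx => ?_
  rw [extendZero_of_mem f hx, extendZero_of_mem g hx, ← dist_eq_norm]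
  exact BoundedContinuousFunction.dist_coe_le_dist _

theorem isClosed_densitySet (a b : Fin d → ℝ) (ω : ℝ≥0 → ℝ≥0) (δ : ℝ≥0) :
    IsClosed (densitySet a b ω δ) := by
  have hev : ∀ x, Continuous fun f : box a b →ᵇ ℝ => f x := fun x =>
    (BoundedContinuousFunction.lipschitz_eval_const x).continuous
  have h1 : IsClosed {f : box a b →ᵇ ℝ | ∀ x, 0 ≤ f x} := by
    simp only [Set.ofPred_forall]
    exact isClosed_iInter fun x => isClosed_le continuous_const (hev x)
  have h2 : IsClosed {f : box a b →ᵇ ℝ | ∀ x y, nndist x y < δ →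
      nndist (f x) (f y) ≤ ω (nndist x y)} := by
    simp only [Set.ofPred_forall]
    exact isClosed_iInter fun x => isClosed_iInter fun y => isClosed_iInter fun _ =>
      isClosed_le ((hev x).nndist (hev y)) continuous_const
  exact h1.inter ((isClosed_eq continuous_integral_extendZero continuous_const).inter h2)

/-- Uniform equicontinuity of the class of densities. -/
theorem exists_forall_abs_sub_le {ω : ℝ≥0 → ℝ≥0} (hω : IsModulus ω) {δ : ℝ≥0} (hδ : 0 < δ)
    {η : ℝ} (hη : 0 < η) : ∃ τ : ℝ, 0 < τ ∧ ∀ f ∈ densitySet a b ω δ, ∀ x y : box a b,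
      dist x y ≤ τ → |f x - f y| ≤ η := by
  have h := hω.tendsto.eventually_lt_const (Real.toNNReal_pos.2 hη)
  obtain ⟨s, hs, hsω⟩ := (mem_nhdsGT_iff_exists_Ioo_subset).1 h
  rw [Set.mem_Ioi] at hs
  have hpos : 0 < min s δ / 2 := half_pos (lt_min hs hδ)
  have hlt : min s δ / 2 < min s δ := NNReal.half_lt_self (lt_min hs hδ).ne'
  refine ⟨(min s δ / 2 : ℝ≥0), by exact_mod_cast hpos, fun f hf x y hxy => ?_⟩
  have hxy' : nndist x y ≤ min s δ / 2 := by exact_mod_cast hxy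
  have h1 := hf.2.2 x y (hxy'.trans_lt (hlt.trans_le (min_le_right _ _)))
  have h2 : ω (nndist x y) ≤ η.toNNReal := by
    refine (hω.monotone hxy').trans (le_of_lt ?_)
    exact hsω ⟨hpos, hlt.trans_le (min_le_left _ _)⟩
  have h3 := h1.trans h2
  rw [← NNReal.coe_le_coe, Real.coe_toNNReal _ hη.le, coe_nndist, Real.dist_eq] at h3
  exact h3

/-- Uniformly over the class of densities, the normalization of the bins is close to one, and the
value of a density at a point is close to its value at the centre of a bin that contains it. -/
theorem eventually_abs_one_sub_binMass_le (hab : ∀ i, a i < b i) {ω : ℝ≥0 → ℝ≥0}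
    (hω : IsModulus ω) {δ : ℝ≥0} (hδ : 0 < δ) {η : ℝ} (hη : 0 < η) :
    ∀ᶠ n in atTop, ∀ f ∈ densitySet a b ω δ, |1 - binMass a b n (extendZero f)| ≤ η ∧
      ∀ (x : box a b) (k : Fin (n ^ d)),
        (x : EuclideanSpace ℝ (Fin d)) ∈ box (binLower a b n k) (binUpper a b n k) →
        |extendZero f (binCenter a b n k) - f x| ≤ η := by
  have hv := volume_real_box_pos hab
  set η' := min η (η / volume.real (box a b))
  have hη'0 : 0 < η' := lt_min hη (div_pos hη hv)
  obtain ⟨τ, hτ, hosc⟩ := exists_forall_abs_sub_le (a := a) (b := b) hω hδ hη'0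
  have hmesh : Tendsto (fun n : ℕ => (∑ i, (b i - a i)) / (n : ℝ)) atTop (𝓝 0) :=
    tendsto_const_div_atTop_nhds_zero_nat _
  filter_upwards [hmesh.eventually_le_const hτ, eventually_gt_atTop 0] with n hn hn0 f hf
  constructor
  · rw [← hf.2.1]
    refine (abs_integral_sub_binMass_le hab hn0 (integrableOn_extendZero f)
      fun x hx y hy hxy => ?_).trans ((mul_le_mul_of_nonneg_right (min_le_right η _) hv.le).trans
        (div_mul_cancel₀ _ hv.ne').le)
    rw [extendZero_of_mem f hx, extendZero_of_mem f hy]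
    exact hosc f hf ⟨x, hx⟩ ⟨y, hy⟩ (hxy.trans hn)
  · intro x k hx
    have hc := binCenter_mem_box hab hn0 k
    have hd : dist (⟨_, hc⟩ : box a b) x ≤ τ := by
      rw [Subtype.dist_eq]
      exact (dist_le_of_mem_box_bin (binCenter_mem_box_bin hab hn0 k) hx).trans hn
    rw [extendZero_of_mem f hc]
    exact (hosc f hf _ x hd).trans (min_le_left _ _)

/-- The densities are uniformly bounded: a large value at one point forces a large value at the
centre of a bin around it, and hence a large midpoint sum, which is close to the total mass one. -/
theorem exists_forall_le_of_mem_densitySet (hab : ∀ i, a i < b i) {ω : ℝ≥0 → ℝ≥0}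
    (hω : IsModulus ω) {δ : ℝ≥0} (hδ : 0 < δ) :
    ∃ M : ℝ, ∀ f ∈ densitySet a b ω δ, ∀ x, f x ≤ M := by
  obtain ⟨n, hn, hn0⟩ := ((eventually_abs_one_sub_binMass_le (a := a) (b := b) hab hω hδ
    one_pos).and (eventually_gt_atTop 0)).exists
  have hh := binVolume_pos hab hn0
  refine ⟨2 / binVolume a b n + 1, fun f hf x => ?_⟩
  obtain ⟨h1, h2⟩ := hn f hf
  obtain ⟨k, hk⟩ := exists_mem_box_bin hab hn0 x.2
  have h3 : extendZero f (binCenter a b n k) * binVolume a b n ≤ binMass a b n (extendZero f) := by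
    refine Finset.single_le_sum (f := fun k => extendZero f (binCenter a b n k) * binVolume a b n)
      (fun j _ => mul_nonneg ?_ hh.le) (Finset.mem_univ k)
    rw [extendZero_of_mem f (binCenter_mem_box hab hn0 j)]
    exact hf.1 _
  have h4 : extendZero f (binCenter a b n k) ≤ 2 / binVolume a b n := by
    rw [le_div_iff₀ hh]
    linarith [(abs_le.1 h1).1]
  linarith [(abs_le.1 (h2 x k hk)).1]

/-- The Arzelà-Ascoli theorem for the class of densities. -/
theorem isCompact_densitySet (hab : ∀ i, a i < b i) {ω : ℝ≥0 → ℝ≥0}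
    (hω : IsModulus ω) {δ : ℝ≥0} (hδ : 0 < δ) : IsCompact (densitySet a b ω δ) := by
  obtain ⟨M, hM⟩ := exists_forall_le_of_mem_densitySet (a := a) (b := b) hab hω hδ
  refine BoundedContinuousFunction.arzela_ascoli₂ (Set.Icc 0 M) isCompact_Icc _
    (isClosed_densitySet a b ω δ) (fun f x hf => ⟨hf.1 x, hM f hf x⟩)
    (UniformEquicontinuous.equicontinuous (Metric.uniformEquicontinuous_iff.2 fun η hη => ?_))
  obtain ⟨τ, hτ, h⟩ := exists_forall_abs_sub_le (a := a) (b := b) hω hδ (half_pos hη)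
  exact ⟨τ, hτ, fun x y hxy f => (h f f.2 x y hxy.le).trans_lt (half_lt_self hη)⟩

/-- Up to the normalization, which tends to one uniformly, the density bins are point values of the
density; hence each point value is a uniform limit of bins. -/
theorem eventually_exists_abs_sub_binDensity_le (hab : ∀ i, a i < b i) {ω : ℝ≥0 → ℝ≥0}
    (hω : IsModulus ω) {δ : ℝ≥0} (hδ : 0 < δ) (x : box a b) {η : ℝ} (hη : 0 < η) :
    ∀ᶠ n in atTop, ∃ k, ∀ f ∈ densitySet a b ω δ,
      |f x - binDensity a b n (extendZero f) k| ≤ η := by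
  obtain ⟨M, hM⟩ := exists_forall_le_of_mem_densitySet (a := a) (b := b) hab hω hδ
  set θ := min (1 / 2) (η / (2 * (|M| + 1)))
  have hM1 : 0 < 2 * (|M| + 1) := by positivity
  have hθ0 : 0 < θ := lt_min (by norm_num) (div_pos hη hM1)
  filter_upwards [eventually_abs_one_sub_binMass_le (a := a) (b := b) hab hω hδ hθ0,
    eventually_gt_atTop 0] with n hn hn0
  obtain ⟨k, hk⟩ := exists_mem_box_bin hab hn0 x.2
  refine ⟨k, fun f hf => ?_⟩
  obtain ⟨h1, h2⟩ := hn f hf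
  have h3 := h2 x k hk
  have hS : 1 / 2 ≤ binMass a b n (extendZero f) := by
    have := (abs_le.1 (h1.trans (min_le_left _ _))).2
    linarith
  rw [binDensity]
  set S := binMass a b n (extendZero f)
  set y := extendZero f (binCenter a b n k)
  have hS0 : 0 < S := by linarith
  have hfx : |f x| ≤ |M| := by
    rw [abs_of_nonneg (hf.1 x)]
    exact (hM f hf x).trans (le_abs_self M)
  have e : f x - y / S = ((f x - y) - f x * (1 - S)) / S := by
    field_simp
    ring
  rw [e, abs_div, abs_of_pos hS0, div_le_iff₀ hS0]
  have h4 : |(f x - y) - f x * (1 - S)| ≤ θ + |M| * θ := by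
    refine (abs_sub _ _).trans (add_le_add ?_ ?_)
    · rwa [abs_sub_comm]
    · rw [abs_mul]
      exact mul_le_mul hfx h1 (abs_nonneg _) (abs_nonneg _)
  have h5 : θ * (2 * (|M| + 1)) ≤ η := (le_div_iff₀ hM1).1 (min_le_right _ _)
  nlinarith

/-! ### The measures with densities in the class -/

/-- The probability measure with a density from `densitySet`. -/
noncomputable def densityMeasure {ω : ℝ≥0 → ℝ≥0} {δ : ℝ≥0} (f : densitySet a b ω δ) : P2 d where
  toMeasure := (volume.restrict (box a b)).withDensity
    fun x => ENNReal.ofReal (extendZero f.1 x)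
  isProbabilityMeasure := by
    constructor
    rw [withDensity_apply _ MeasurableSet.univ, Measure.restrict_univ,
      ← ofReal_integral_eq_lintegral_ofReal (integrableOn_extendZero f.1), f.2.2.1,
      ENNReal.ofReal_one]
    refine (ae_restrict_iff' (measurableSet_box a b)).2 (ae_of_all _ fun x hx => ?_)
    rw [extendZero_of_mem f.1 hx]
    exact f.2.1 _
  secondMoment_lt_top := by
    obtain ⟨C, hC⟩ := (isCompact_box a b).isBounded.exists_norm_le
    have hae : ∀ᵐ x ∂(volume.restrict (box a b)).withDensity
        fun x => ENNReal.ofReal (extendZero f.1 x), ‖x‖ₑ ^ 2 ≤ ENNReal.ofReal C ^ 2 := by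
      refine (withDensity_absolutelyContinuous _ _).ae_le
        ((ae_restrict_iff' (measurableSet_box a b)).2 (ae_of_all _ fun x hx => ?_))
      rw [← ofReal_norm]
      exact pow_le_pow_left' (ENNReal.ofReal_le_ofReal (hC x hx)) 2
    refine (lintegral_mono_ae hae).trans_lt ?_
    rw [lintegral_const, withDensity_apply _ MeasurableSet.univ, Measure.restrict_univ]
    exact ENNReal.mul_lt_top (by simp) (integrableOn_extendZero f.1).lintegral_lt_top

/-- Uniform convergence of densities on the rectangle implies convergence of the measures in the
Wasserstein distance. -/
theorem continuous_densityMeasure {ω : ℝ≥0 → ℝ≥0} {δ : ℝ≥0} :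
    Continuous (densityMeasure : densitySet a b ω δ → P2 d) := by
  refine continuous_def.2 fun U hU => Metric.isOpen_iff.2 fun f hf => ?_
  obtain ⟨r, hr, hrU⟩ := hU _ hf
  set R := Metric.ediam (box a b)
  have hRtop : R ≠ ∞ := (isCompact_box a b).isBounded.ediam_ne_top
  have hle : ∀ g : densitySet a b ω δ, W2 (densityMeasure f) (densityMeasure g) ≤
      (R ^ 2 * (edist f g * volume (box a b))) ^ (1 / 2 : ℝ) := by
    intro g
    refine (W2_le_of_withDensity (ρ := volume.restrict (box a b))
      (measurable_extendZero f.1).ennreal_ofReal (measurable_extendZero g.1).ennreal_ofReal rfl rfl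
      (ae_restrict_mem (measurableSet_box a b)) (R := R)
      fun x hx y hy => Metric.edist_le_ediam_of_mem hx hy).trans ?_
    gcongr
    rw [← setLIntegral_const]
    refine setLIntegral_mono' (measurableSet_box a b) fun x hx => ?_
    rw [extendZero_of_mem f.1 hx, extendZero_of_mem g.1 hx, edist_dist,
      ← ENNReal.ofReal_sub _ (g.2.1 _)]
    exact ENNReal.ofReal_le_ofReal ((le_abs_self _).trans
      (BoundedContinuousFunction.dist_coe_le_dist (f := f.1) (g := g.1) ⟨x, hx⟩))
  have hcont : Tendsto (fun g : densitySet a b ω δ =>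
      (R ^ 2 * (edist f g * volume (box a b))) ^ (1 / 2 : ℝ)) (𝓝 f) (𝓝 0) := by
    have h1 : Tendsto (fun g : densitySet a b ω δ => edist f g) (𝓝 f) (𝓝 0) := by
      have := (continuous_const.edist continuous_id : Continuous fun g => edist f g).tendsto f
      simpa using this
    have h2 := ENNReal.Tendsto.const_mul (a := R ^ 2)
      (ENNReal.Tendsto.mul_const h1 (Or.inr (volume_box_lt_top a b).ne))
      (Or.inr (ENNReal.pow_ne_top hRtop))
    have h3 := h2.ennrpow_const (1 / 2 : ℝ)
    simpa using h3
  obtain ⟨s, hs, hsr⟩ := Metric.eventually_nhds_iff_ball.1 (hcont.eventually_lt_const hr)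
  exact ⟨s, hs, fun g hg => hrU _ ((hle g).trans_lt (hsr g hg))⟩

/-- A measure with a continuous density on the rectangle, of the prescribed modulus of continuity,
is one of the measures `densityMeasure f`. -/
theorem HasContinuousDensityOn.exists_densityMeasure_eq {μ : P2 d}
    {f : EuclideanSpace ℝ (Fin d) → ℝ} (hf : HasContinuousDensityOn μ (box a b) f)
    {ω : ℝ≥0 → ℝ≥0} {δ : ℝ≥0} (hω : ∀ t < δ, modulusOn f (box a b) t ≤ (ω t : ℝ≥0∞)) :
    ∃ g : densitySet a b ω δ, densityMeasure g = μ ∧ ∀ x ∈ box a b, extendZero g.1 x = f x := by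
  set g : box a b →ᵇ ℝ := BoundedContinuousFunction.mkOfCompact
    ⟨(box a b).domRestrict f, hf.continuousOn.domRestrict⟩
  have hgf : ∀ x ∈ box a b, extendZero g x = f x := fun x hx => extendZero_of_mem g hx
  have hμ : μ.toMeasure = (volume.restrict (box a b)).withDensity
      fun x => ENNReal.ofReal (extendZero g x) := by
    have h1 : μ.toMeasure.restrict (box a b) = μ.toMeasure :=
      Measure.restrict_eq_self_of_ae_mem (mem_ae_iff.2 hf.measure_compl)
    rw [← h1, hf.eq_withDensity, restrict_withDensity (measurableSet_box a b)]
    refine withDensity_congr_ae ((ae_restrict_iff' (measurableSet_box a b)).2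
      (ae_of_all _ fun x hx => ?_))
    simp only [hgf x hx]
  have hint : ∫ x in box a b, extendZero g x = 1 := by
    have h1 := μ.isProbabilityMeasure.measure_univ
    have h2 : 0 ≤ᵐ[volume.restrict (box a b)] extendZero g :=
      (ae_restrict_iff' (measurableSet_box a b)).2 (ae_of_all _ fun x hx => by
        rw [hgf x hx]; exact hf.nonneg x)
    rw [hμ, withDensity_apply _ MeasurableSet.univ, Measure.restrict_univ,
      ← ofReal_integral_eq_lintegral_ofReal (integrableOn_extendZero g) h2] at h1
    exact ENNReal.ofReal_eq_one.1 h1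
  refine ⟨⟨g, fun x => hf.nonneg x, hint, fun x y hxy => ?_⟩, ?_, hgf⟩
  · have h1 : edist (f x) (f y) ≤ modulusOn f (box a b) (nndist x y) :=
      le_iSup₂_of_le x.1 x.2 (le_iSup₂_of_le y.1 y.2 (le_iSup_of_le le_rfl le_rfl))
    have h2 := h1.trans (hω _ hxy)
    rw [edist_nndist] at h2
    exact_mod_cast h2
  · cases μ
    simp only [densityMeasure]
    congr
    exact hμ.symm

end MeanField

/-! ### The approximation theorem -/

/-- Universal approximation by bin-density networks. `K = n ^ d` is the number of bins; `δ` is the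
size of the neighbourhood of `0` on which the moduli of the densities are bounded by `ω`. -/
theorem theorem2p1 {d p : ℕ} (a b : Fin d → ℝ) (hab : ∀ i, a i < b i)
    (ω : ℝ≥0 → ℝ≥0) (hω : MeanField.IsModulus ω) (δ : ℝ≥0) (hδ : 0 < δ)
    (V : EuclideanSpace ℝ (Fin d) → MeanField.P2 d → EuclideanSpace ℝ (Fin p))
    (hV : Continuous fun z : EuclideanSpace ℝ (Fin d) × MeanField.P2 d => V z.1 z.2)
    (σ : ℝ → ℝ) (hσ : Continuous σ)
    (hσ' : ¬ ∃ P : Polynomial ℝ, ∀ t, σ t = P.eval t)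
    (ε : ℝ) (hε : 0 < ε) :
    ∃ n : ℕ, 0 < n ∧ ∃ Φ : MeanField.FeedforwardNet (d + n ^ d) p,
      ∀ (μ : MeanField.P2 d) (f : EuclideanSpace ℝ (Fin d) → ℝ),
        MeanField.HasContinuousDensityOn μ (MeanField.box a b) f →
        (∀ t < δ, MeanField.modulusOn f (MeanField.box a b) t ≤ (ω t : ℝ≥0∞)) →
        0 < MeanField.binMass a b n f ∧
        ∀ x ∈ MeanField.box a b,
          ‖V x μ - WithLp.toLp 2
            (Φ.eval σ (Fin.append (fun i => x i) (MeanField.binDensity a b n f)))‖ ≤ ε := by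
  have : CompactSpace (MeanField.densitySet a b ω δ) :=
    isCompact_iff_compactSpace.1 (MeanField.isCompact_densitySet hab hω hδ)
  let z : ∀ n, MeanField.box a b × MeanField.densitySet a b ω δ →
      Fin (d + n ^ d) → ℝ := fun n q =>
    Fin.append (fun i => q.1.1 i) (MeanField.binDensity a b n (MeanField.extendZero q.2.1))
  have hsep : ∀ q r : MeanField.box a b × MeanField.densitySet a b ω δ,
      q ≠ r → ∃ ℓ ∈ MeanField.asymptoticSpan fun n => MeanField.linearSpan (z n), ℓ q ≠ ℓ r := by
    intro q r hqr
    by_cases hx : q.1 = r.1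
    · have hf : q.2.1 ≠ r.2.1 := fun h => hqr (Prod.ext hx (Subtype.ext h))
      obtain ⟨y, hy⟩ : ∃ y, q.2.1 y ≠ r.2.1 y := by
        by_contra! h
        exact hf (BoundedContinuousFunction.ext h)
      refine ⟨⟨fun q => q.2.1 y, (BoundedContinuousFunction.lipschitz_eval_const y).continuous.comp
        (continuous_subtype_val.comp continuous_snd)⟩, fun η hη => ?_, hy⟩
      filter_upwards [MeanField.eventually_exists_abs_sub_binDensity_le hab hω hδ y hη]
      rintro n ⟨k, hk⟩
      refine ⟨_, Submodule.subset_span ⟨Fin.natAdd d k, rfl⟩, fun q => ?_⟩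
      simpa [z] using hk q.2.1 q.2.2
    · obtain ⟨i, hi⟩ : ∃ i, q.1.1 i ≠ r.1.1 i := by
        by_contra! h
        exact hx (Subtype.ext (PiLp.ext h))
      refine ⟨⟨fun q => q.1.1 i, by fun_prop⟩, fun η hη => Eventually.of_forall fun n =>
        ⟨_, Submodule.subset_span ⟨Fin.castAdd _ i, rfl⟩, fun q => ?_⟩, hi⟩
      simpa [z] using hη.le
  have hv : Continuous fun q : MeanField.box a b × MeanField.densitySet a b ω δ =>
      V q.1 (MeanField.densityMeasure q.2) :=
    hV.comp ((continuous_subtype_val.comp continuous_fst).prodMk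
      (MeanField.continuous_densityMeasure.comp continuous_snd))
  obtain ⟨n, ⟨⟨Φ, hΦ⟩, hmass⟩, hn⟩ :=
    (((MeanField.eventually_exists_feedforwardNet z hσ hσ' hsep hv hε).and
      (MeanField.eventually_abs_one_sub_binMass_le hab hω hδ one_half_pos)).and
      (eventually_gt_atTop 0)).exists
  refine ⟨n, hn, Φ, fun μ f hf hfω => ?_⟩
  obtain ⟨g, rfl, hgf⟩ := hf.exists_densityMeasure_eq hfω
  have hc : ∀ k, f (MeanField.binCenter a b n k) =
      MeanField.extendZero g.1 (MeanField.binCenter a b n k) := fun k =>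
    (hgf _ (MeanField.binCenter_mem_box hab hn k)).symm
  have hm : MeanField.binMass a b n f = MeanField.binMass a b n (MeanField.extendZero g.1) := by
    simp only [MeanField.binMass, hc]
  have hd : MeanField.binDensity a b n f =
      MeanField.binDensity a b n (MeanField.extendZero g.1) := by
    funext k
    simp only [MeanField.binDensity, hc, hm]
  refine ⟨?_, fun x hx => ?_⟩
  · rw [hm]
    linarith [(abs_le.1 (hmass g.1 g.2).1).2]
  · rw [hd]
    exact hΦ (⟨x, hx⟩, g)
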